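/- Let $p$ be a prime, $k$ a field of characteristic $p$, $n\ge 1$, and let $G$ be an elementary abelian group of order $p^n$. Fix an identification $G\cong(\mathbb F_p^n,+)$, $g\mapsto(g_1,\dots,g_n)$. Conventions. A $k$-$G$-algebra is a commutative $k$-algebra $A$ with a right action $a\mapsto (a)g$ of $G$ by $k$-algebra automorphisms. Put $\operatorname{tr}(a)=\sum_{g\in G}(a)g$ and $A^G=\{a: (a)g=a\ \forall g\in G\}$. Let $\mathfrak{Ts}_G$ be the category of finitely generated $k$-$G$-algebras $A$ with $\operatorname{tr}(A)=A^G$, with $G$-equivariant $k$-algebra homomorphisms as morphisms. For objects $A,B$ write $A\prec B$ if there is a monomorphism $A\to B$ in $\mathfrak{Ts}_G$. An object $B$ is *universal* if there is at least one morphism from $B$ to every object of $\mathfrak{Ts}_G$; it is *minimal* if $A\prec B$ implies $B\prec A$ for every object $A$; it is *basic* if it is universal and minimal. The equation $d_k(G)=d$ means that basic objects exist and all have Krull dimension $d$. Let $D_k(G)=k[X_g: g\in G]/(\sum_{g}X_g-1)$, with action $(X_h)g=X_{hg}$. A *standard subalgebra* of $D_k(G)$ is a $G$-stable subalgebra $S\in\mathfrak{Ts}_G$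 such that $D_k(G)=S\oplus J$ for some $G$-stable ideal $J$; an object is called *standard* if it is isomorphic to a standard subalgebra. Let $\mho=k[Y_1,\dots,Y_n]$ be the polynomial ring with $(Y_i)g=Y_i-g_i$. For an embedding of abelian groups $\alpha:G\hookrightarrow k^+$, $g\mapsto\alpha_g$, let $B_\alpha=k[Z]$ be the univariate polynomial ring with $(Z)g=Z-\alpha_g$. **Theorem.** $\mho$ is universal in $\mathfrak{Ts}_G$ and (isomorphic to) a standard subalgebra of $D_k(G)$. Assume now that $\dim_{\mathbb F_p}k\ge n$. Then there are $\mathbb F_p$-linearly independent $\alpha_1,\dots,\alpha_n\in k$, and $g\mapsto\sum_i g_i\alpha_i$ is an embedding of $G$ into $k^+$ with image $\langle\alpha_1,\dots,\alpha_n\rangle_{\mathbb F_p}$. Moreover: 1. For every embedding $\alpha:G\hookrightarrow k^+$, the algebra $B_\alpha$ is a retract of $\mho$ in $\mathfrak{Ts}_G$, and it is standard, universal and basic. In particular $d_k(G)=1$. 2. Every basic object of $\mathfrak{Ts}_G$ which is a normal ring is isomorphic in $\mathfrak{Ts}_G$ to $B_\beta$ for some embedding $\beta:G\hookrightarrow k^+$.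 3. Let $\alpha,\beta:G\hookrightarrow k^+$ be embeddings. Then $B_\alpha\cong B_\beta$ in $\mathfrak{Ts}_G$ if and only if $\alpha=c\cdot\beta$ for some $0\ne c\in k$. There is an automorphism $\eta$ of $G$ such that $B_\alpha$ is isomorphic to the twist $(B_\beta)^\eta$ (the algebra $B_\beta$ on which $g$ acts as $\eta(g)$) if and only if $\alpha(G)=c\cdot\beta(G)$ for some $0\ne c\in k$. 4. For any $n$, not necessarily distinct, embeddings $\alpha^{(1)},\dots,\alpha^{(n)}:G\hookrightarrow k^+$ there is a $G$-equivariant isomorphism of $k$-algebras $\mho\cong B_{\alpha^{(1)}}\otimes_k\cdots\otimes_k B_{\alpha^{(n)}}$, where $G$ acts diagonally on the tensor product. -/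

import Mathlib

open CategoryTheory
open scoped TensorProduct

universe u

/-- A `k`-`G`-algebra: a commutative `k`-algebra with a right action `a ↦ (a)g` of `G` by
`k`-algebra automorphisms; `act g a` is `(a)g`. -/
structure KGAlg (k : Type u) [Field k] (G : Type) [Group G] : Type (u + 1) where
  carrier : Type u
  [commRing : CommRing carrier]
  [algebra : Algebra k carrier]
  act : G → carrier →ₐ[k] carrier
  act_one : act 1 = AlgHom.id k carrier
  act_mul : ∀ g h : G, act (g * h) = (act h).comp (act g)

namespace KGAlg

noncomputable section

variable {k : Type u} [Field k] {G : Type} [Group G]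

attribute [instance] KGAlg.commRing KGAlg.algebra

/-- Morphisms of `k`-`G`-algebras: `G`-equivariant homomorphisms of `k`-algebras. -/
@[ext]
structure Hom (A B : KGAlg k G) where
  toAlgHom : A.carrier →ₐ[k] B.carrier
  equivariant : ∀ (g : G) (a : A.carrier), toAlgHom (A.act g a) = B.act g (toAlgHom a)

instance : Category (KGAlg k G) where
  Hom A B := Hom A B
  id A := { toAlgHom := AlgHom.id k A.carrier, equivariant := fun _ _ => rfl }
  comp f h :=
    { toAlgHom := h.toAlgHom.comp f.toAlgHom
      equivariant := fun g a => by
        simp only [AlgHom.comp_apply, f.equivariant, h.equivariant] }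

/-- The trace (transfer) map `tr(a) = ∑ (a)g`. -/
def trace [Fintype G] (A : KGAlg k G) (a : A.carrier) : A.carrier := ∑ g : G, A.act g a

/-- The set `A^G` of invariants. -/
def invariants (A : KGAlg k G) : Set A.carrier := {a | ∀ g : G, A.act g a = a}

/-- Membership in the category `Ts_G` of finitely generated trace-surjective `k`-`G`-algebras,
which is the full subcategory of `KGAlg k G` on these objects. -/
def IsTs [Fintype G] (A : KGAlg k G) : Prop :=
  Algebra.FiniteType k A.carrier ∧ Set.range A.trace = A.invariants

/-- `f` is a monomorphism of the category `Ts_G`. -/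
def IsTsMono [Fintype G] {A B : KGAlg k G} (f : A ⟶ B) : Prop :=
  ∀ C : KGAlg k G, IsTs C → ∀ x y : C ⟶ A, x ≫ f = y ≫ f → x = y

/-- The relation `A ≺ B`: there is a monomorphism `A ⟶ B` in `Ts_G`. -/
def Precedes [Fintype G] (A B : KGAlg k G) : Prop := ∃ f : A ⟶ B, IsTsMono f

/-- `B` is universal: a weakly initial object of `Ts_G`. -/
def IsUniversal [Fintype G] (B : KGAlg k G) : Prop :=
  IsTs B ∧ ∀ A : KGAlg k G, IsTs A → Nonempty (B ⟶ A)

/-- `B` is a minimal object of `Ts_G`. -/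
def IsMinimal [Fintype G] (B : KGAlg k G) : Prop :=
  IsTs B ∧ ∀ A : KGAlg k G, IsTs A → Precedes A B → Precedes B A

/-- `B` is basic: universal and minimal. -/
def IsBasic [Fintype G] (B : KGAlg k G) : Prop := IsUniversal B ∧ IsMinimal B

/-- `d_k(G) = d`: basic objects exist, and all of them have Krull dimension `d`. -/
def HasBasicDimension (k : Type u) [Field k] (G : Type) [Group G] [Fintype G] (d : ℕ) : Prop :=
  (∃ B : KGAlg k G, IsBasic B) ∧
    ∀ B : KGAlg k G, IsBasic B → ringKrullDim B.carrier = (d : WithBot ℕ∞)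

/-- The ideal generated by `∑ X_g - 1`. -/
def dehomIdeal (k : Type u) [Field k] (G : Type) [Group G] [Fintype G] :
    Ideal (MvPolynomial G k) :=
  Ideal.span {(∑ g : G, MvPolynomial.X g) - 1}

theorem dehomIdeal_le_comap [Fintype G] (g : G) :
    dehomIdeal k G ≤ (dehomIdeal k G).comap
      (MvPolynomial.rename (fun h => h * g) : MvPolynomial G k →ₐ[k] MvPolynomial G k) := by
  rw [dehomIdeal, Ideal.span_le, Set.singleton_subset_iff]
  have h1 : (∑ h : G, (MvPolynomial.X (h * g) : MvPolynomial G k)) = ∑ h : G, MvPolynomial.X h :=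
    Fintype.sum_equiv (Equiv.mulRight g) _ _ (fun _ => rfl)
  simp only [SetLike.mem_coe, Ideal.mem_comap, map_sub, map_sum, MvPolynomial.rename_X, map_one,
    h1]
  exact Ideal.subset_span rfl

/-- The algebra `D_k(G) = k[X_g : g ∈ G] / (∑ X_g - 1)`, with `(x_h)g = x_{hg}`. -/
def dehom (k : Type u) [Field k] (G : Type) [Group G] [Fintype G] : KGAlg k G where
  carrier := MvPolynomial G k ⧸ dehomIdeal k G
  act g := Ideal.quotientMapₐ (dehomIdeal k G) (MvPolynomial.rename (fun h => h * g))
    (dehomIdeal_le_comap g)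
  act_one := by
    apply Ideal.Quotient.algHom_ext
    ext h
    simp
  act_mul g g' := by
    apply Ideal.Quotient.algHom_ext
    ext h
    simp [mul_assoc]

/-- `A` is (up to isomorphism) a standard subalgebra of `D_k(G)`: it is in `Ts_G` and embeds
equivariantly in `D_k(G)` with image `S` such that `D_k(G) = S ⊕ J` for a `G`-stable ideal `J`. -/
def IsStandard [Fintype G] (A : KGAlg k G) : Prop :=
  IsTs A ∧ ∃ i : A ⟶ dehom k G, Function.Injective i.toAlgHom ∧
    ∃ J : Ideal (dehom k G).carrier,
      (∀ (g : G), ∀ x ∈ J, (dehom k G).act g x ∈ J) ∧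
      IsCompl (Subalgebra.toSubmodule i.toAlgHom.range) (J.restrictScalars k)

/-- For a homomorphism `α : G → k⁺`, the algebra `B_α = k[Z]` with `(Z)g = Z - α_g`. -/
def univariate (α : Additive G →+ k) : KGAlg k G where
  carrier := Polynomial k
  act g := Polynomial.aeval (Polynomial.X - Polynomial.C (α (Additive.ofMul g)))
  act_one := by
    ext
    simp
  act_mul g h := by
    ext1
    simp only [ofMul_mul, map_add, Polynomial.aeval_X, AlgHom.comp_apply, map_sub,
      Polynomial.aeval_C, Polynomial.algebraMap_eq]
    ring

/-- For an identification `e : G ≃ 𝔽_p^n`, `g ↦ (g_1, …, g_n)`, the algebra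
`k[Y_1, …, Y_n]` with `(Y_i)g = Y_i - g_i`. -/
def multivariate {p n : ℕ} [Algebra (ZMod p) k] (e : Additive G ≃+ (Fin n → ZMod p)) :
    KGAlg k G where
  carrier := MvPolynomial (Fin n) k
  act g := MvPolynomial.aeval fun i =>
    MvPolynomial.X i - MvPolynomial.C (algebraMap (ZMod p) k (e (Additive.ofMul g) i))
  act_one := by
    ext1 i
    simp
  act_mul g h := by
    ext1 i
    simp only [ofMul_mul, map_add, Pi.add_apply, MvPolynomial.aeval_X, AlgHom.comp_apply, map_sub,
      MvPolynomial.aeval_C, MvPolynomial.algebraMap_eq]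
    ring

/-- The homomorphism `G → k⁺`, `g ↦ ∑ g_i a_i`, where `g ↦ (g_1, …, g_n)` is `e`. -/
def coordHom {p n : ℕ} [Algebra (ZMod p) k] (e : Additive G ≃+ (Fin n → ZMod p))
    (a : Fin n → k) : Additive G →+ k where
  toFun g := ∑ i, e g i • a i
  map_zero' := by simp
  map_add' g h := by simp [add_smul, Finset.sum_add_distrib]

/-- The tensor product over `k` of a family of `k`-`G`-algebras, with the diagonal action
`(a_1 ⊗ ⋯ ⊗ a_n)g = (a_1)g ⊗ ⋯ ⊗ (a_n)g`. -/
def tensor {ι : Type} (A : ι → KGAlg k G) : KGAlg k G where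
  carrier := ⨂[k] i, (A i).carrier
  act g := PiTensorProduct.liftAlgHom
    ((PiTensorProduct.tprod k).compLinearMap fun i => ((A i).act g).toLinearMap)
    (by
      simp only [MultilinearMap.compLinearMap_apply, Pi.one_apply, AlgHom.toLinearMap_apply,
        map_one]
      rfl)
    (fun x y => by
      simp only [MultilinearMap.compLinearMap_apply, Pi.mul_apply, AlgHom.toLinearMap_apply,
        map_mul, PiTensorProduct.tprod_mul_tprod]
      rfl)
  act_one := by
    apply AlgHom.toLinearMap_injective
    apply PiTensorProduct.ext
    ext x
    simp [KGAlg.act_one]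
  act_mul g h := by
    apply AlgHom.toLinearMap_injective
    apply PiTensorProduct.ext
    ext x
    simp [KGAlg.act_mul]

/-- The twist `A^η` of `A` by an automorphism `η` of `G`: the same algebra, on which `g` acts as
`η(g)` does on `A`. -/
def twist (A : KGAlg k G) (η : G ≃* G) : KGAlg k G where
  carrier := A.carrier
  act g := A.act (η g)
  act_one := by rw [map_one, A.act_one]
  act_mul g h := by rw [map_mul, A.act_mul]

end

end KGAlg

namespace KGAlg

noncomputable section

variable {k : Type u} [Field k] {G : Type} [Group G]

/-! Everything rests on weighted orbit sums. If `tr(a) = 1` and `l : G → k⁺` is additive, then `y =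
∑ l(g) (a)g` satisfies `(y)h = y - l(h)` (`act_orbitSum`). So a polynomial ring on which `G`
translates the variables maps to every object of `Ts_G`, and is universal once it has an element of
trace one. For `B_α` such an element is the Lagrange basis polynomial at the node `0` of `α(G)`; for
`℧` it is a product of these. Interpolating `Z` shows that its orbit sums return the generators, so
these algebras are retracts of `D_k(G)`.

A morphism `B_α → B_β` with `α` injective is composition with a non-constant polynomial, hence
injective; this makes `B_α` minimal. Monomorphisms of `Ts_G` are injective
(`injective_of_isTsMono`), so a basic object embeds in `k[Z]` with a non-constant polynomial in its
image. Then `k[Z]` is integral over it and its dimension is one. If it is normal, a Lüroth-type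
argument (`exists_generator`) shows that it is `k[w]`, and comparing degrees shows that `G`
translates `w`.

For the tensor decomposition, once one variable `Y_j` carries an injective `l_j`, the other
translations can be changed at will by adding polynomials in `Y_j` (`nonempty_shift_iso`). -/

@[simp]
theorem comp_toAlgHom {A B C : KGAlg k G} (f : A ⟶ B) (g : B ⟶ C) :
    Hom.toAlgHom (f ≫ g) = (Hom.toAlgHom g).comp (Hom.toAlgHom f) := rfl

theorem hom_ext {A B : KGAlg k G} {f g : A ⟶ B} (h : Hom.toAlgHom f = Hom.toAlgHom g) : f = g :=
  Hom.ext h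

theorem act_act (A : KGAlg k G) (g h : G) (a : A.carrier) :
    A.act h (A.act g a) = A.act (g * h) a := by rw [A.act_mul, AlgHom.comp_apply]

/-- An equivariant algebra isomorphism is an isomorphism of `k`-`G`-algebras. -/
def isoOfInverse {A B : KGAlg k G} (f : A ⟶ B) (φ : B.carrier →ₐ[k] A.carrier)
    (h₁ : φ.comp (Hom.toAlgHom f) = AlgHom.id k _) (h₂ : (Hom.toAlgHom f).comp φ = AlgHom.id k _) :
    A ≅ B where
  hom := f
  inv :=
    { toAlgHom := φ
      equivariant := fun g b => by
        have h := Hom.equivariant f g (φ b)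
        have hb : f.toAlgHom (φ b) = b := DFunLike.congr_fun h₂ b
        rw [hb] at h
        rw [← h]
        exact DFunLike.congr_fun h₁ _ }
  hom_inv_id := hom_ext h₁
  inv_hom_id := hom_ext h₂

/-! ### Elements of trace one and weighted orbit sums -/

section Trace

variable [Fintype G]

theorem act_trace (A : KGAlg k G) (h : G) (a : A.carrier) : A.act h (A.trace a) = A.trace a := by
  simp only [trace, map_sum, act_act]
  exact Fintype.sum_equiv (Equiv.mulRight h) _ _ fun _ => rfl

/-- The trace is linear over the invariants, so its image is all of them as soon as it contains `1`.
-/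
theorem isTs_iff (A : KGAlg k G) :
    IsTs A ↔ Algebra.FiniteType k A.carrier ∧ ∃ a, A.trace a = 1 := by
  refine and_congr_right fun _ => ⟨fun h => ?_, ?_⟩
  · have : (1 : A.carrier) ∈ A.invariants := fun g => map_one _
    rwa [← h] at this
  · rintro ⟨a, ha⟩
    refine Set.Subset.antisymm ?_ fun b hb => ⟨a * b, ?_⟩
    · rintro _ ⟨b, rfl⟩ g
      exact act_trace A g b
    · have hb' : ∀ g, A.act g b = b := hb
      simp only [trace, map_mul, hb', ← Finset.sum_mul] at ha ⊢
      rw [ha, one_mul]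

theorem map_trace {A B : KGAlg k G} (f : A ⟶ B) (a : A.carrier) :
    f.toAlgHom (A.trace a) = B.trace (f.toAlgHom a) := by
  simp only [trace, map_sum, f.equivariant]

theorem IsTs.of_hom {A B : KGAlg k G} (hA : IsTs A) (f : A ⟶ B)
    (hB : Algebra.FiniteType k B.carrier) : IsTs B := by
  obtain ⟨-, a, ha⟩ := (isTs_iff A).1 hA
  exact (isTs_iff B).2 ⟨hB, f.toAlgHom a, by rw [← map_trace, ha, map_one]⟩

/-- The weighted orbit sum `∑ l_g (a)g`. -/
def orbitSum (A : KGAlg k G) (l : Additive G →+ k) (a : A.carrier) : A.carrier :=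
  ∑ g : G, l (Additive.ofMul g) • A.act g a

/-- Substitute `l(g) = l(gh) - l(h)` in `∑ l(g) (a)gh`: the first part is the orbit sum again, the
second is `l(h) tr(a) = l(h)`. -/
theorem act_orbitSum (A : KGAlg k G) (l : Additive G →+ k) {a : A.carrier} (ha : A.trace a = 1)
    (h : G) : A.act h (A.orbitSum l a) =
      A.orbitSum l a - algebraMap k A.carrier (l (Additive.ofMul h)) := by
  have key : ∑ g : G, l (Additive.ofMul (g * h)) • A.act (g * h) a = A.orbitSum l a :=
    Fintype.sum_equiv (Equiv.mulRight h) _ _ fun _ => rfl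
  have hact : A.act h (A.orbitSum l a) =
      ∑ g : G, l (Additive.ofMul g) • A.act (g * h) a := by
    simp only [orbitSum, map_sum, map_smul, act_act]
  have htr : ∑ g : G, A.act (g * h) a = 1 :=
    (Fintype.sum_equiv (Equiv.mulRight h) (fun g => A.act (g * h) a) (fun g => A.act g a)
      fun _ => rfl).trans ha
  rw [hact, ← key]
  simp only [ofMul_mul, map_add, add_smul, Finset.sum_add_distrib, ← Finset.smul_sum, htr]
  rw [Algebra.algebraMap_eq_smul_one, add_sub_cancel_right]

theorem map_orbitSum {A B : KGAlg k G} (f : A ⟶ B) (l : Additive G →+ k) (a : A.carrier) :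
    f.toAlgHom (A.orbitSum l a) = B.orbitSum l (f.toAlgHom a) := by
  simp only [orbitSum, map_sum, map_smul, f.equivariant]

end Trace

/-! ### Polynomial rings with translation action -/

/-- The polynomial ring `k[Y_i]` with `(Y_i)g = Y_i - l_i(g)`. -/
def shift {ι : Type} (l : ι → Additive G →+ k) : KGAlg k G where
  carrier := MvPolynomial ι k
  act g := MvPolynomial.aeval fun i =>
    MvPolynomial.X i - MvPolynomial.C (l i (Additive.ofMul g))
  act_one := by
    ext1 i
    simp
  act_mul g h := by
    ext1 i
    simp only [ofMul_mul, map_add, MvPolynomial.aeval_X, AlgHom.comp_apply, map_sub,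
      MvPolynomial.aeval_C, MvPolynomial.algebraMap_eq]
    ring

/-- The coordinate homomorphisms `g ↦ g_i`. -/
def coord {p n : ℕ} [Algebra (ZMod p) k] (e : Additive G ≃+ (Fin n → ZMod p)) (i : Fin n) :
    Additive G →+ k :=
  (algebraMap (ZMod p) k).toAddMonoidHom.comp ((Pi.evalAddMonoidHom _ i).comp e.toAddMonoidHom)

theorem multivariate_eq_shift {p n : ℕ} [Algebra (ZMod p) k]
    (e : Additive G ≃+ (Fin n → ZMod p)) : multivariate (k := k) e = shift (coord e) := rfl

/-- Morphisms out of `shift l`. -/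
def shiftLift {ι : Type} (l : ι → Additive G →+ k) (A : KGAlg k G) (y : ι → A.carrier)
    (hy : ∀ g i, A.act g (y i) = y i - algebraMap k _ (l i (Additive.ofMul g))) :
    shift l ⟶ A where
  toAlgHom := (MvPolynomial.aeval y : MvPolynomial ι k →ₐ[k] A.carrier)
  equivariant g a := by
    have : (MvPolynomial.aeval y : MvPolynomial ι k →ₐ[k] A.carrier).comp ((shift l).act g) =
        (A.act g).comp (MvPolynomial.aeval y : MvPolynomial ι k →ₐ[k] A.carrier) := by
      refine MvPolynomial.algHom_ext fun i => ?_
      change MvPolynomial.aeval y (MvPolynomial.aeval _ (MvPolynomial.X i)) =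
        A.act g (MvPolynomial.aeval y (MvPolynomial.X i))
      simp only [MvPolynomial.aeval_X, map_sub, MvPolynomial.aeval_C, hy]
    exact DFunLike.congr_fun this a

/-- Morphisms out of `univariate α`. -/
def univariateLift (α : Additive G →+ k) (A : KGAlg k G) (z : A.carrier)
    (hz : ∀ g, A.act g z = z - algebraMap k _ (α (Additive.ofMul g))) :
    univariate α ⟶ A where
  toAlgHom := (Polynomial.aeval z : Polynomial k →ₐ[k] A.carrier)
  equivariant g a := by
    have : (Polynomial.aeval z : Polynomial k →ₐ[k] A.carrier).comp ((univariate α).act g) =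
        (A.act g).comp (Polynomial.aeval z : Polynomial k →ₐ[k] A.carrier) := by
      refine Polynomial.algHom_ext ?_
      change Polynomial.aeval z (Polynomial.aeval _ Polynomial.X) =
        A.act g (Polynomial.aeval z Polynomial.X)
      simp only [Polynomial.aeval_X, map_sub, Polynomial.aeval_C, hz]
    exact DFunLike.congr_fun this a

/-- The generator `Y_i` of `shift l`. -/
def shiftX {ι : Type} (l : ι → Additive G →+ k) (i : ι) : (shift l).carrier :=
  (MvPolynomial.X i : MvPolynomial ι k)

/-- The generator `Z` of `univariate α`. -/
def univariateX (α : Additive G →+ k) : (univariate α).carrier := (Polynomial.X : Polynomial k)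

theorem shift_algHom_ext {ι : Type} {l : ι → Additive G →+ k} {R : Type*} [Semiring R] [Algebra k R]
    {φ ψ : (shift l).carrier →ₐ[k] R}
    (h : ∀ i, φ (shiftX l i) = ψ (shiftX l i)) :
    φ = ψ :=
  MvPolynomial.algHom_ext h

theorem shiftLift_X {ι : Type} (l : ι → Additive G →+ k) (A : KGAlg k G) (y : ι → A.carrier)
    (hy : ∀ g i, A.act g (y i) = y i - algebraMap k _ (l i (Additive.ofMul g))) (i : ι) :
    (shiftLift l A y hy).toAlgHom (shiftX l i) = y i :=
  MvPolynomial.aeval_X _ _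

theorem univariate_algHom_ext {α : Additive G →+ k} {R : Type*} [Semiring R] [Algebra k R]
    {φ ψ : (univariate α).carrier →ₐ[k] R}
    (h : φ (univariateX α) = ψ (univariateX α)) : φ = ψ :=
  Polynomial.algHom_ext h

theorem univariateLift_X (α : Additive G →+ k) (A : KGAlg k G) (z : A.carrier)
    (hz : ∀ g, A.act g z = z - algebraMap k _ (α (Additive.ofMul g))) :
    (univariateLift α A z hz).toAlgHom (univariateX α) = z :=
  Polynomial.aeval_X _

theorem shift_act_X {ι : Type} (l : ι → Additive G →+ k) (g : G) (i : ι) :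
    (shift l).act g (shiftX l i) =
      shiftX l i - algebraMap k _ (l i (Additive.ofMul g)) :=
  MvPolynomial.aeval_X _ _

theorem univariate_act_X (α : Additive G →+ k) (g : G) :
    (univariate α).act g (univariateX α) =
      univariateX α - algebraMap k _ (α (Additive.ofMul g)) :=
  Polynomial.aeval_X (A := Polynomial k) _

theorem univariate_act_eq_comp (α : Additive G →+ k) (g : G) (q : Polynomial k) :
    (univariate α).act g q =
      q.comp (Polynomial.X - Polynomial.C (α (Additive.ofMul g)) : Polynomial k) :=
  Polynomial.comp_eq_aeval.symm

theorem nonempty_hom_shift [Fintype G] {ι : Type} (l : ι → Additive G →+ k) {A : KGAlg k G}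
    (hA : IsTs A) : Nonempty (shift l ⟶ A) := by
  obtain ⟨-, a, ha⟩ := (isTs_iff A).1 hA
  exact ⟨shiftLift l A (fun i => A.orbitSum (l i) a) fun g i => A.act_orbitSum _ ha g⟩

theorem nonempty_hom_univariate [Fintype G] (α : Additive G →+ k) {A : KGAlg k G}
    (hA : IsTs A) : Nonempty (univariate α ⟶ A) := by
  obtain ⟨-, a, ha⟩ := (isTs_iff A).1 hA
  exact ⟨univariateLift α A (A.orbitSum α a) fun g => A.act_orbitSum _ ha g⟩

/-! ### Retracts of `D_k(G)` -/

section Standard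

variable [Fintype G]

/-- The class of `X_h` in `D_k(G)`. -/
def dehomX (h : G) : (dehom k G).carrier := Ideal.Quotient.mk (dehomIdeal k G) (MvPolynomial.X h)

theorem dehom_act_X (g h : G) : (dehom k G).act g (dehomX h) = dehomX (h * g) := by
  change Ideal.quotientMapₐ _ _ _ (Ideal.Quotient.mk _ _) = _
  rw [Ideal.quotient_map_mkₐ]
  simp [dehomX]

theorem dehom_trace : (dehom k G).trace (dehomX 1) = 1 := by
  simp only [trace, dehom_act_X, one_mul]
  change ∑ g : G, Ideal.Quotient.mk (dehomIdeal k G) (MvPolynomial.X g) = 1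
  rw [← map_sum, ← map_one (Ideal.Quotient.mk (dehomIdeal k G)), Ideal.Quotient.mk_eq_mk_iff_sub_mem]
  exact Ideal.subset_span rfl

/-- The morphism `D_k(G) ⟶ A` given by an element of trace one. -/
def dehomLift (A : KGAlg k G) (a : A.carrier) (ha : A.trace a = 1) : dehom k G ⟶ A where
  toAlgHom := Ideal.Quotient.liftₐ (dehomIdeal k G) (MvPolynomial.aeval fun g => A.act g a) (by
    intro x hx
    have : dehomIdeal k G ≤ RingHom.ker (MvPolynomial.aeval (R := k) fun g => A.act g a) := by
      rw [dehomIdeal, Ideal.span_le, Set.singleton_subset_iff]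
      simpa [RingHom.mem_ker, sub_eq_zero, trace] using ha
    exact this hx)
  equivariant g x := by
    obtain ⟨x, rfl⟩ := Ideal.Quotient.mk_surjective x
    change Ideal.Quotient.liftₐ _ _ _ (Ideal.quotientMapₐ _ _ _ (Ideal.Quotient.mk _ _)) = _
    rw [Ideal.quotient_map_mkₐ]
    change MvPolynomial.aeval _ (MvPolynomial.rename _ x) = A.act g (MvPolynomial.aeval _ x)
    have : (MvPolynomial.aeval (R := k) fun g => A.act g a).comp
        (MvPolynomial.rename fun h => h * g) =
        (A.act g).comp (MvPolynomial.aeval (R := k) fun g => A.act g a) := by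
      refine MvPolynomial.algHom_ext fun i => ?_
      simp [act_act]
    exact DFunLike.congr_fun this x

theorem dehomLift_X (A : KGAlg k G) (a : A.carrier) (ha : A.trace a = 1) :
    (dehomLift A a ha).toAlgHom (dehomX 1) = a := by
  change MvPolynomial.aeval _ (MvPolynomial.X 1) = _
  simp [A.act_one]

/-- The kernel of the retraction is the required `G`-stable complement. -/
theorem isStandard_of_retract {A : KGAlg k G} (hA : IsTs A) (i : A ⟶ dehom k G)
    (r : dehom k G ⟶ A) (h : i ≫ r = 𝟙 A) : IsStandard A := by
  have hr : ∀ a, r.toAlgHom (i.toAlgHom a) = a := fun a =>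
    DFunLike.congr_fun (congrArg Hom.toAlgHom h) a
  refine ⟨hA, i, Function.LeftInverse.injective hr, RingHom.ker r.toAlgHom, fun g x hx => ?_, ?_⟩
  · rw [RingHom.mem_ker] at hx ⊢
    rw [r.equivariant, hx, map_zero]
  · rw [isCompl_iff, Submodule.disjoint_def, codisjoint_iff, Submodule.eq_top_iff']
    constructor
    · rintro _ ⟨a, rfl⟩ ha
      have : r.toAlgHom (i.toAlgHom a) = 0 := ha
      rw [hr] at this
      simp [this]
    · intro x
      rw [Submodule.mem_sup]
      refine ⟨i.toAlgHom (r.toAlgHom x), ⟨_, rfl⟩, x - i.toAlgHom (r.toAlgHom x), ?_, by abel⟩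
      change r.toAlgHom _ = 0
      rw [map_sub, hr, sub_self]

/-- If `a` has trace one and the orbit sums of `a` recover the generators, then `shift l` is
standard. -/
theorem isStandard_shift {ι : Type} [Finite ι] (l : ι → Additive G →+ k) (a : (shift l).carrier)
    (ha : (shift l).trace a = 1)
    (hl : ∀ i, (shift l).orbitSum (l i) a = shiftX l i) :
    IsStandard (shift l) := by
  refine isStandard_of_retract
    ((isTs_iff _).2 ⟨inferInstanceAs (Algebra.FiniteType k (MvPolynomial ι k)), a, ha⟩)
    (shiftLift l _ (fun i => (dehom k G).orbitSum (l i) (dehomX 1))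
      fun g i => act_orbitSum _ _ dehom_trace g) (dehomLift _ a ha) (hom_ext ?_)
  refine shift_algHom_ext fun i => ?_
  rw [comp_toAlgHom, AlgHom.comp_apply, shiftLift_X, map_orbitSum, dehomLift_X, hl]
  rfl

theorem isStandard_univariate (α : Additive G →+ k) (a : (univariate α).carrier)
    (ha : (univariate α).trace a = 1)
    (hα : (univariate α).orbitSum α a = univariateX α) :
    IsStandard (univariate α) := by
  refine isStandard_of_retract
    ((isTs_iff _).2 ⟨inferInstanceAs (Algebra.FiniteType k (Polynomial k)), a, ha⟩)
    (univariateLift α _ ((dehom k G).orbitSum α (dehomX 1))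
      fun g => act_orbitSum _ _ dehom_trace g) (dehomLift _ a ha) (hom_ext ?_)
  refine univariate_algHom_ext ?_
  rw [comp_toAlgHom, AlgHom.comp_apply, univariateLift_X, map_orbitSum, dehomLift_X, hα]
  rfl

end Standard
-- Elements of trace one from Lagrange interpolation
section Lagrange

variable {H : Type*} [AddCommGroup H] [Fintype H] [DecidableEq H]

/-- The Lagrange basis polynomial of `h` for the nodes `v`. -/
def nodal (v : H →+ k) (h : H) : Polynomial k := Lagrange.basis Finset.univ v h

/-- The nodes form a subgroup, so a translation by a node permutes them and hence the basis
polynomials. -/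
theorem nodal_comp (v : H →+ k) (h h' : H) :
    (nodal v h).comp (Polynomial.X - Polynomial.C (v h')) = nodal v (h + h') := by
  rw [nodal, nodal, Lagrange.basis, Lagrange.basis, Polynomial.prod_comp]
  refine Finset.prod_equiv (Equiv.addRight h') (fun j => by simp) fun j _ => ?_
  simp only [Lagrange.basisDivisor, Polynomial.mul_comp, Polynomial.C_comp, Polynomial.sub_comp,
    Polynomial.X_comp, Equiv.coe_addRight, map_add, add_sub_add_right_eq_sub]
  ring

theorem sum_nodal {v : H →+ k} (hv : Function.Injective v) : ∑ h, nodal v h = 1 :=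
  Lagrange.sum_basis hv.injOn Finset.univ_nonempty

/-- This is the interpolation of `X` at the nodes; it is exact because `X` has degree `1`, less than
the number of nodes. -/
theorem sum_smul_nodal [Nontrivial H] {v : H →+ k} (hv : Function.Injective v) :
    ∑ h, v h • nodal v h = Polynomial.X := by
  have h := Lagrange.eq_interpolate (s := Finset.univ) (f := Polynomial.X) hv.injOn (by
    rw [Polynomial.degree_X, Finset.card_univ]
    exact_mod_cast Fintype.one_lt_card)
  rw [h, Lagrange.interpolate_apply]
  simp [Polynomial.smul_eq_C_mul, nodal]

end Lagrange

theorem exists_trace_eq_one_univariate [Fintype G] [Nontrivial G] {α : Additive G →+ k}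
    (hα : Function.Injective α) (hc : ∀ g h : G, g * h = h * g) :
    ∃ a, (univariate α).trace a = 1 ∧ (univariate α).orbitSum α a = univariateX α := by
  classical
  let _ : AddCommGroup (Additive G) := { (inferInstance : AddGroup (Additive G)) with
    add_comm := fun a b => hc a b }
  have hact : ∀ g : G, (univariate α).act g (nodal α 0) = nodal α (Additive.ofMul g) := by
    intro g
    rw [univariate_act_eq_comp, nodal_comp, zero_add]
  refine ⟨nodal α 0, ?_, ?_⟩
  · simp only [trace, hact]
    exact (Fintype.sum_equiv Additive.ofMul _ _ fun _ => rfl).trans (sum_nodal hα)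
  · simp only [orbitSum, hact]
    exact (Fintype.sum_equiv Additive.ofMul _ _ fun _ => rfl).trans (sum_smul_nodal hα)

/-- The witness is the product over `i` of the basis polynomial at `0 ∈ 𝔽_p` in `Y_i`. A sum over `G
≅ 𝔽_p^n` of such products factors into one-variable sums. -/
theorem exists_trace_eq_one_coord [Fintype G] {p n : ℕ} [Fact p.Prime] [Algebra (ZMod p) k]
    (e : Additive G ≃+ (Fin n → ZMod p)) :
    ∃ a, (shift (coord (k := k) e)).trace a = 1 ∧
      ∀ i, (shift (coord e)).orbitSum (coord e i) a = shiftX (coord e) i := by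
  let v : ZMod p →+ k := (algebraMap (ZMod p) k).toAddMonoidHom
  have hv : Function.Injective v := (algebraMap (ZMod p) k).injective
  let P : (Fin n → ZMod p) → MvPolynomial (Fin n) k := fun x =>
    ∏ i, Polynomial.aeval (MvPolynomial.X i : MvPolynomial (Fin n) k) (nodal v (x i))
  have hact : ∀ g : G, (shift (coord e)).act g (P 0) = P (e (Additive.ofMul g)) := by
    intro g
    change MvPolynomial.aeval (fun i => (MvPolynomial.X i : MvPolynomial (Fin n) k) -
      MvPolynomial.C (algebraMap (ZMod p) k (e (Additive.ofMul g) i))) (P 0) =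
      P (e (Additive.ofMul g))
    simp only [P, map_prod]
    refine Finset.prod_congr rfl fun i _ => ?_
    rw [← Polynomial.aeval_algHom_apply, MvPolynomial.aeval_X, Pi.zero_apply,
      ← zero_add (e _ i), ← nodal_comp, Polynomial.comp_eq_aeval, ← Polynomial.aeval_algHom_apply]
    simp [v]
  have hsum : ∀ F : Fin n → ZMod p → MvPolynomial (Fin n) k,
      ∑ g : G, ∏ i, F i (e (Additive.ofMul g) i) = ∏ i, ∑ c, F i c := by
    intro F
    rw [Finset.prod_univ_sum, Fintype.piFinset_univ]
    exact Fintype.sum_equiv (Additive.ofMul.trans e.toEquiv) _ (fun x => ∏ i, F i (x i))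
      fun _ => rfl
  have h1 : ∀ i : Fin n, ∑ c, Polynomial.aeval (MvPolynomial.X i : MvPolynomial (Fin n) k)
      (nodal v c) = 1 := by
    intro i
    rw [← map_sum, sum_nodal hv, map_one]
  refine ⟨P 0, ?_, fun j => ?_⟩
  · simp only [trace, hact]
    exact (hsum fun i c => Polynomial.aeval (MvPolynomial.X i : MvPolynomial (Fin n) k)
      (nodal v c)).trans (Finset.prod_eq_one fun i _ => h1 i)
  · simp only [orbitSum, hact]
    -- The weight `g_j` is absorbed into the `j`-th factor, which then sums to `Y_j` while the
    -- others sum to `1`.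
    let F : Fin n → ZMod p → MvPolynomial (Fin n) k := fun i c =>
      (if i = j then v c else 1) •
        Polynomial.aeval (MvPolynomial.X i : MvPolynomial (Fin n) k) (nodal v c)
    have hF : ∀ x, ∏ i, F i (x i) = v (x j) • P x := by
      intro x
      simp only [F, Finset.prod_smul, Finset.prod_ite_eq', Finset.mem_univ, if_true, P]
    have h2 : ∀ i, ∑ c, F i c = if i = j then MvPolynomial.X i else 1 := by
      intro i
      split_ifs with hij
      · simp only [F, if_pos hij]
        simp only [← map_smul, ← map_sum, sum_smul_nodal hv, Polynomial.aeval_X]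
      · simp only [F, if_neg hij, one_smul, h1]
    have h3 := hsum F
    simp only [hF, h2, Finset.prod_ite_eq', Finset.mem_univ, if_true] at h3
    exact h3

section Fintype

variable [Fintype G]

theorem isTs_univariate {α : Additive G →+ k} (h : ∃ a, (univariate α).trace a = 1) :
    IsTs (univariate α) :=
  (isTs_iff _).2 ⟨inferInstanceAs (Algebra.FiniteType k (Polynomial k)), h⟩

theorem isTs_shift {ι : Type} [Finite ι] {l : ι → Additive G →+ k}
    (h : ∃ a, (shift l).trace a = 1) : IsTs (shift l) :=
  (isTs_iff _).2 ⟨inferInstanceAs (Algebra.FiniteType k (MvPolynomial ι k)), h⟩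

end Fintype

/-! ### Morphisms between the algebras `B_α` -/

/-- Morphisms `B_α ⟶ B_β` are given by non-constant polynomials. -/
theorem natDegree_endo_pos {α : Additive G →+ k} (hα : Function.Injective α) [Nontrivial G]
    {β : Additive G →+ k} (f : univariate α ⟶ univariate β) :
    0 < Polynomial.natDegree (R := k) (f.toAlgHom (univariateX α)) := by
  by_contra! h
  obtain ⟨c, hc⟩ : ∃ c : k, Polynomial.C c = f.toAlgHom (univariateX α) :=
    ⟨_, (Polynomial.eq_C_of_natDegree_le_zero h).symm⟩
  -- A constant image would be fixed by `g`, whereas `Z` is moved by `α(g) ≠ 0`.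
  obtain ⟨g, hg⟩ := exists_ne (1 : G)
  have h1 := f.equivariant g (univariateX α)
  rw [univariate_act_X, map_sub, AlgHom.commutes, ← hc] at h1
  have h2 : (univariate β).act g (Polynomial.C c : Polynomial k) = (Polynomial.C c : Polynomial k) :=
    AlgHom.commutes _ c
  rw [h2] at h1
  have h3 : (Polynomial.C c : Polynomial k) - Polynomial.C (α (Additive.ofMul g)) =
    Polynomial.C c := h1
  rw [sub_eq_self, Polynomial.C_eq_zero, map_eq_zero_iff α hα] at h3
  exact hg h3

theorem endo_eq_comp {α β : Additive G →+ k} (f : univariate α ⟶ univariate β)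
    (q : (univariate α).carrier) :
    f.toAlgHom q = Polynomial.comp (R := k) q (f.toAlgHom (univariateX α)) := by
  refine Eq.trans ?_ Polynomial.comp_eq_aeval.symm
  have : Hom.toAlgHom f = (Polynomial.aeval (R := k) (A := Polynomial k)
      (f.toAlgHom (univariateX α)) : Polynomial k →ₐ[k] Polynomial k) := by
    refine univariate_algHom_ext ?_
    exact (Polynomial.aeval_X (R := k) (A := Polynomial k) _).symm
  exact DFunLike.congr_fun this q

theorem endo_injective {α : Additive G →+ k} (hα : Function.Injective α) [Nontrivial G]
    {β : Additive G →+ k} (f : univariate α ⟶ univariate β) : Function.Injective f.toAlgHom := by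
  rw [injective_iff_map_eq_zero]
  intro q hq
  replace hq := (endo_eq_comp f q).symm.trans hq
  have h := natDegree_endo_pos hα f
  rcases Polynomial.comp_eq_zero_iff.1 hq with h0 | ⟨-, h1⟩
  · exact h0
  · rw [h1, Polynomial.natDegree_C] at h
    exact absurd h (lt_irrefl _)

/-! ### Minimality, universality and monomorphisms -/

section Universal

variable [Fintype G]

theorem isTsMono_of_injective {A B : KGAlg k G} (f : A ⟶ B) (hf : Function.Injective f.toAlgHom) :
    IsTsMono f := fun _ _ _ _ h => hom_ext <| AlgHom.ext fun c => hf <|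
  DFunLike.congr_fun (congrArg Hom.toAlgHom h) c

/-- Given `A → B_α`, universality supplies `B_α → A`; the composite endomorphism of `B_α` is
injective, hence so is its first factor. -/
theorem isMinimal_univariate {α : Additive G →+ k} (hα : Function.Injective α) [Nontrivial G]
    (h : IsTs (univariate α)) : IsMinimal (univariate α) := by
  refine ⟨h, fun A hA ⟨f, _⟩ => ?_⟩
  obtain ⟨φ⟩ := nonempty_hom_univariate α hA
  refine ⟨φ, isTsMono_of_injective φ ?_⟩
  have := endo_injective hα (φ ≫ f)
  exact Function.Injective.of_comp (f := f.toAlgHom) this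

theorem isUniversal_univariate {α : Additive G →+ k} (h : IsTs (univariate α)) :
    IsUniversal (univariate α) := ⟨h, fun _ hA => nonempty_hom_univariate α hA⟩

/-- The polynomial ring `k[Y_i, X_h]` with `(Y_i)g = Y_i - l_i(g)` and `(X_h)g = X_{hg}`. -/
def shiftRegular {ι : Type} (l : ι → Additive G →+ k) : KGAlg k G where
  carrier := MvPolynomial (ι ⊕ G) k
  act g := MvPolynomial.aeval <| Sum.elim
    (fun i => MvPolynomial.X (Sum.inl i) - MvPolynomial.C (l i (Additive.ofMul g)))
    (fun h => MvPolynomial.X (Sum.inr (h * g)))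
  act_one := by
    ext1 i
    rcases i with i | i <;> simp
  act_mul g h := by
    ext1 i
    rcases i with i | i
    · simp only [ofMul_mul, map_add, MvPolynomial.aeval_X, AlgHom.comp_apply, map_sub,
        MvPolynomial.aeval_C, MvPolynomial.algebraMap_eq, Sum.elim_inl]
      ring
    · simp [mul_assoc]

/-- Adjoining a free orbit `X_h` to `k[Y_i]` gives a test object of `Ts_G`: with the images of the
`Y_i` in `A` fixed, its generator `X_1` can be sent to any element of `A`. If `f x = f y`, the
morphisms with `X_1 ↦ x` and `X_1 ↦ y` agree after `f`. -/
theorem injective_of_isTsMono {ι : Type} [Finite ι] {l : ι → Additive G →+ k}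
    (hl : IsTs (shift l)) {A B : KGAlg k G} (hA : IsTs A) (f : A ⟶ B) (hf : IsTsMono f) :
    Function.Injective f.toAlgHom := by
  intro x y hxy
  obtain ⟨φ⟩ := nonempty_hom_shift l hA
  let z : ι → A.carrier := fun i => φ.toAlgHom (shiftX l i)
  have hz : ∀ g i, A.act g (z i) = z i - algebraMap k _ (l i (Additive.ofMul g)) := by
    intro g i
    simp only [z]
    rw [← φ.equivariant, shift_act_X, map_sub, AlgHom.commutes]
  let i₀ : shift l ⟶ shiftRegular l :=
    shiftLift l _ (fun i => (MvPolynomial.X (Sum.inl i) : MvPolynomial (ι ⊕ G) k))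
      fun g i => MvPolynomial.aeval_X _ _
  have hC : IsTs (shiftRegular l) :=
    hl.of_hom i₀ (inferInstanceAs (Algebra.FiniteType k (MvPolynomial (ι ⊕ G) k)))
  let ev : A.carrier → (shiftRegular l ⟶ A) := fun a =>
    { toAlgHom := (MvPolynomial.aeval (Sum.elim z fun h => A.act h a) :
        MvPolynomial (ι ⊕ G) k →ₐ[k] A.carrier)
      equivariant := fun g b => by
        have : (MvPolynomial.aeval (Sum.elim z fun h => A.act h a) :
            MvPolynomial (ι ⊕ G) k →ₐ[k] A.carrier).comp ((shiftRegular l).act g) =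
            (A.act g).comp (MvPolynomial.aeval (Sum.elim z fun h => A.act h a) :
            MvPolynomial (ι ⊕ G) k →ₐ[k] A.carrier) := by
          refine MvPolynomial.algHom_ext fun i => ?_
          change MvPolynomial.aeval (Sum.elim z fun h => A.act h a)
            (MvPolynomial.aeval _ (MvPolynomial.X i)) = A.act g (MvPolynomial.aeval _ _)
          rcases i with i | i
          · simp [hz]
          · simp [act_act]
        exact DFunLike.congr_fun this b }
  have h : ev x = ev y := by
    refine hf _ hC _ _ (hom_ext ?_)
    refine MvPolynomial.algHom_ext fun i => ?_
    change f.toAlgHom (MvPolynomial.aeval _ (MvPolynomial.X i)) =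
      f.toAlgHom (MvPolynomial.aeval _ (MvPolynomial.X i))
    rcases i with i | i
    · simp
    · simp [f.equivariant, hxy]
  have h1 : (ev x).toAlgHom (MvPolynomial.X (Sum.inr 1) : MvPolynomial (ι ⊕ G) k) =
    (ev y).toAlgHom (MvPolynomial.X (Sum.inr 1) : MvPolynomial (ι ⊕ G) k) := by rw [h]
  have h2 : ∀ a, (ev a).toAlgHom (MvPolynomial.X (Sum.inr 1) : MvPolynomial (ι ⊕ G) k) = a := by
    intro a
    change MvPolynomial.aeval _ (MvPolynomial.X _) = _
    simp [A.act_one]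
  rwa [h2, h2] at h1

end Universal

/-! ### Integrality and Krull dimension -/

/-- `k[Z]` is integral over every subalgebra that contains a non-constant polynomial. -/
theorem isIntegral_of_natDegree_pos {A : Type*} [CommRing A] [Algebra k A]
    (f : A →ₐ[k] Polynomial k) (a : A) (ha : 0 < (f a).natDegree) : f.toRingHom.IsIntegral := by
  have hX : f.toRingHom.IsIntegralElem Polynomial.X := by
    have hc : (f a).leadingCoeff ≠ 0 := by
      rw [Polynomial.leadingCoeff_ne_zero]
      rintro h
      simp [h] at ha
    -- With `W = f a`, the polynomial `W(T) - a` vanishes at `T = X`; dividing by the leading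
    -- coefficient of `W` makes it monic, since `W` is non-constant.
    refine ⟨((f a).map (algebraMap k A) - Polynomial.C a) *
      Polynomial.C (algebraMap k A (f a).leadingCoeff⁻¹), ?_, ?_⟩
    · nontriviality A
      apply Polynomial.monic_mul_C_of_leadingCoeff_mul_eq_one
      rw [Polynomial.leadingCoeff_sub_of_degree_lt, Polynomial.leadingCoeff_map, ← map_mul,
        mul_inv_cancel₀ hc, map_one]
      refine lt_of_le_of_lt Polynomial.degree_C_le ?_
      rw [Polynomial.degree_map]
      exact Polynomial.natDegree_pos_iff_degree_pos.1 ha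
    · have : f.toRingHom.comp (algebraMap k A) = Polynomial.C := f.comp_algebraMap
      rw [Polynomial.eval₂_mul, Polynomial.eval₂_sub, Polynomial.eval₂_map, this,
        Polynomial.eval₂_C_X, Polynomial.eval₂_C]
      simp
  intro q
  induction q using Polynomial.induction_on with
  | C c =>
    have : Polynomial.C c = f.toRingHom (algebraMap k A c) := (f.commutes c).symm
    rw [this]
    exact f.toRingHom.isIntegralElem_map
  | add p q hp hq => exact hp.add _ hq
  | monomial n c h =>
    rw [pow_succ, ← mul_assoc]
    exact h.mul _ hX

/-- A non-zero prime of `A` lies under a non-zero, hence maximal, prime of `k[Z]`, so it is maximal.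
`A` is not a field, as otherwise `k[Z]` would be one. -/
theorem ringKrullDim_eq_one_of_isIntegral {A : Type*} [CommRing A]
    (f : A →+* Polynomial k) (hf : Function.Injective f) (hi : f.IsIntegral) :
    ringKrullDim A = 1 := by
  let _ := f.toAlgebra
  have : IsDomain A := hf.isDomain f
  have : Algebra.IsIntegral A (Polynomial k) := ⟨hi⟩
  have hbot : RingHom.ker (algebraMap A (Polynomial k)) = ⊥ :=
    (RingHom.injective_iff_ker_eq_bot f).1 hf
  have hle : Ring.KrullDimLE 1 A := by
    rw [Ring.krullDimLE_one_iff_of_noZeroDivisors]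
    intro I hI hI'
    obtain ⟨Q, hQ, rfl⟩ := Ideal.exists_ideal_over_prime_of_isIntegral_of_isDomain
      (S := Polynomial k) I (hbot.trans_le bot_le)
    have hQ0 : Q ≠ ⊥ := by
      rintro rfl
      exact hI hbot
    have := hQ.isMaximal hQ0
    exact Ideal.isMaximal_comap_of_isIntegral_of_isMaximal Q
  have hnf : ¬ IsField A := fun h =>
    Polynomial.not_isField k (isField_of_isIntegral_of_isField' h)
  have h0 : ringKrullDim A ≠ 0 := fun h => by
    rw [← ringKrullDimZero_iff_ringKrullDim_eq_zero] at h
    exact hnf Ring.KrullDimLE.isField_of_isDomain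
  have h1 : ringKrullDim A ≤ 1 := (Order.krullDimLE_iff _ _).1 hle
  have h2 : 0 ≤ ringKrullDim A := ringKrullDim_nonneg_of_nontrivial
  exact le_antisymm h1 (ENat.WithBot.add_one_le_iff.2 (lt_of_le_of_ne h2 h0.symm))
-- Normal subalgebras of `k[Z]` are generated by one element
open Polynomial in
theorem coeff_coeff_swap (M : k[X][X]) (i j : ℕ) :
    ((Bivariate.swap M).coeff i).coeff j = (M.coeff j).coeff i := by
  induction M using Polynomial.induction_on' with
  | add p q hp hq => simp only [map_add, coeff_add, hp, hq]
  | monomial n a =>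
    induction a using Polynomial.induction_on' with
    | add p q hp hq => simp only [map_add, coeff_add, hp, hq]
    | monomial m c =>
      rw [Bivariate.swap_monomial_monomial]
      simp only [coeff_monomial]
      split_ifs <;> simp_all [coeff_monomial]

open Polynomial in
/-- A divisor of `W(T) - W(Z)`, one of whose coefficients is `W(Z)`, is associated to it. -/
theorem map_sub_C_dvd (W : k[X]) (hW : 0 < W.natDegree) (M : k[X][X]) (i : ℕ)
    (hi : M.coeff i = W) (hd : M ∣ W.map C - C W) : W.map C - C W ∣ M := by
  obtain ⟨H, hH⟩ := hd
  have hs : C W - W.map C = Bivariate.swap M * Bivariate.swap H := by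
    rw [← map_mul, ← hH, map_sub, Bivariate.swap_map_C, Bivariate.swap_C]
  have hdeg : (C W - W.map C).natDegree = W.natDegree := by
    rw [← natDegree_neg, neg_sub, natDegree_sub_C, natDegree_map_eq_of_injective C_injective]
  have hlead : (C W - W.map C).leadingCoeff = C (-W.leadingCoeff) := by
    rw [leadingCoeff, hdeg, coeff_sub, coeff_C_of_ne_zero hW.ne', coeff_map, zero_sub, C_neg]
    rfl
  have hW0 : W.leadingCoeff ≠ 0 := by
    rw [leadingCoeff_ne_zero]
    rintro rfl
    simp at hW
  have hne : Bivariate.swap M * Bivariate.swap H ≠ 0 := by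
    rw [← hs, ← leadingCoeff_ne_zero, hlead]
    simpa using hW0
  -- The coefficient `W(Z)` forces `M` to have full degree in `Z`. So the cofactor `H` is free of
  -- `Z`, and it is a unit because the leading coefficient in `Z` of the product is a non-zero
  -- constant.
  have hM : W.natDegree ≤ (Bivariate.swap M).natDegree := by
    refine le_natDegree_of_ne_zero fun h => hW0 ?_
    have := coeff_coeff_swap M W.natDegree i
    rwa [h, hi, coeff_zero, eq_comm] at this
  rw [hs, natDegree_mul (left_ne_zero_of_mul hne) (right_ne_zero_of_mul hne)] at hdeg
  obtain ⟨h₀, hh₀⟩ : ∃ h₀, C h₀ = Bivariate.swap H :=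
    ⟨_, (eq_C_of_natDegree_le_zero (by omega)).symm⟩
  have hunit : IsUnit h₀ := by
    rw [hs, leadingCoeff_mul, ← hh₀, leadingCoeff_C] at hlead
    refine isUnit_of_mul_isUnit_right (x := (Bivariate.swap M).leadingCoeff) ?_
    rw [hlead]
    exact isUnit_C.2 (neg_ne_zero.2 hW0).isUnit
  have hHu : IsUnit H := by
    have := (hunit.map C).map (Bivariate.swap (R := k))
    rwa [hh₀, Bivariate.swap_swap_apply] at this
  rw [hH, hHu.mul_right_dvd]

open Polynomial in
-- The fraction `t / s` of `A` becomes `v`, which is integral over `A`; so `t / s` is integral and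
-- lies in `A` by normality.
theorem exists_of_map_eq_mul {A B : Type*} [CommRing A] [IsDomain A] [IsIntegrallyClosed A]
    [CommRing B] [IsDomain B] (f : A →+* B) (hf : Function.Injective f) (hi : f.IsIntegral)
    {s t : A} {v : B} (hs : s ≠ 0) (h : f t = f s * v) : ∃ y, f y = v := by
  let K := FractionRing A
  let L := FractionRing B
  have hg : Function.Injective ((algebraMap B L).comp f) :=
    (IsFractionRing.injective B L).comp hf
  let φ : K →+* L := IsFractionRing.lift hg
  have hφ : ∀ a, φ (algebraMap A K a) = algebraMap B L (f a) := fun a =>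
    IsFractionRing.lift_algebraMap hg a
  have hfs : f s ≠ 0 := (map_ne_zero_iff f hf).2 hs
  have hx : φ (algebraMap A K t / algebraMap A K s) = algebraMap B L v := by
    rw [map_div₀, hφ, hφ, h, map_mul, mul_div_cancel_left₀]
    exact (map_ne_zero_iff _ (IsFractionRing.injective B L)).2 hfs
  have hint : IsIntegral A (algebraMap A K t / algebraMap A K s) := by
    obtain ⟨P, hP, hPv⟩ := hi v
    refine ⟨P, hP, φ.injective ?_⟩
    rw [Polynomial.hom_eval₂, map_zero, hx]
    have : φ.comp (algebraMap A K) = (algebraMap B L).comp f := RingHom.ext hφ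
    rw [this, ← Polynomial.hom_eval₂, hPv, map_zero]
  obtain ⟨y, hy⟩ := IsIntegrallyClosed.isIntegral_iff.1 hint
  refine ⟨y, IsFractionRing.injective B L ?_⟩
  rw [← hφ, hy, hx]

open Polynomial in
-- As in Lüroth's theorem, `w` is a non-constant coefficient of the minimal polynomial `M` of `Z`
-- over `A`. For every `u` in `A`, with images `U` and `W` of `u` and `w`, `M` divides `U(T) -
-- U(Z)`; as `M` is associated to `W(T) - W(Z)`, the latter divides `U(T) - U(Z)` too.
theorem exists_generator {A : Type*} [CommRing A] [Algebra k A] [IsIntegrallyClosed A]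
    (f : A →ₐ[k] k[X]) (hf : Function.Injective f) (hi : f.toRingHom.IsIntegral) :
    ∃ w : A, 0 < (f w).natDegree ∧ ∀ u : A, ∃ q : k[X], aeval w q = u := by
  let _ := f.toRingHom.toAlgebra
  have : IsDomain A := hf.isDomain f.toRingHom
  have : FaithfulSMul A k[X] := (faithfulSMul_iff_algebraMap_injective _ _).2 hf
  have hmap : ∀ a, algebraMap A k[X] a = f a := fun _ => rfl
  have hcomp : (algebraMap A k[X]).comp (algebraMap k A) = C := f.comp_algebraMap
  have hX : IsIntegral A (X : k[X]) := hi X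
  let m := minpoly A (X : k[X])
  let M := m.map (algebraMap A k[X])
  have hMm : M.Monic := (minpoly.monic hX).map _
  have hMX : M.eval X = 0 := by
    rw [eval_map_algebraMap]
    exact minpoly.aeval _ _
  obtain ⟨i, hi0⟩ : ∃ i, 0 < (M.coeff i).natDegree := by
    -- If all coefficients were constant, `Z` would be a root of a monic polynomial over `k`.
    by_contra! h
    have hM : (M.map (evalRingHom 0)).map C = M := by
      ext1 i
      rw [coeff_map, coeff_map, coe_evalRingHom, ← coeff_zero_eq_eval_zero]
      exact (eq_C_of_natDegree_le_zero (h i)).symm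
    have h0 : M.map (evalRingHom 0) = 0 := by
      rwa [← hM, Polynomial.eval_map, eval₂_C_X] at hMX
    rw [h0, Polynomial.map_zero] at hM
    exact hMm.ne_zero hM.symm
  have hdvd : ∀ u : A, M ∣ (f u).map C - C (f u) := by
    intro u
    have h1 : m ∣ (f u).map (algebraMap k A) - C u := by
      refine minpoly.isIntegrallyClosed_dvd hX ?_
      rw [map_sub, aeval_C, aeval_def, eval₂_map, hcomp, eval₂_C_X, hmap, sub_self]
    have h2 := Polynomial.map_dvd (algebraMap A k[X]) h1
    rwa [Polynomial.map_sub, Polynomial.map_map, hcomp, map_C, hmap] at h2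
  let w := m.coeff i
  have hw : M.coeff i = f w := coeff_map _ _
  rw [hw] at hi0
  have hkey : ∀ u : A, f w - C ((f w).eval 0) ∣ f u - C ((f u).eval 0) := by
    -- The divisibility is specialised at `Z = 0`.
    intro u
    have h := Polynomial.map_dvd (evalRingHom (0 : k))
      ((map_sub_C_dvd (f w) hi0 M i hw (hdvd w)).trans (hdvd u))
    have hid : (evalRingHom (0 : k)).comp C = RingHom.id k := by ext; simp
    simpa [Polynomial.map_sub, Polynomial.map_map, hid] using h
  refine ⟨w, hi0, fun u => ?_⟩
  -- Division of `u - U(0)` by `w - W(0)` leaves a quotient of smaller degree, which lies in `A` by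
  -- normality.
  induction hn : (f u).natDegree using Nat.strong_induction_on generalizing u with
  | _ n ih =>
    obtain ⟨v, hv⟩ := hkey u
    have hsub : ∀ a c, f (a - algebraMap k A c) = f a - C c := fun a c => by
      rw [map_sub, f.commutes]; rfl
    have hs0 : f w - C ((f w).eval 0) ≠ 0 := fun h => by
      rw [sub_eq_zero] at h
      rw [h, natDegree_C] at hi0
      exact lt_irrefl _ hi0
    obtain ⟨y, hy⟩ := exists_of_map_eq_mul f.toRingHom hf hi
      (s := w - algebraMap k A ((f w).eval 0)) (t := u - algebraMap k A ((f u).eval 0)) (v := v)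
      (fun h => hs0 (by rw [← hsub, h, map_zero]))
      (by
        change f _ = f _ * _
        rw [hsub, hsub, hv])
    change f y = v at hy
    have huy : u = algebraMap k A ((f u).eval 0) + (w - algebraMap k A ((f w).eval 0)) * y := by
      refine hf ?_
      rw [map_add, map_mul, hsub, hy, ← hv, f.commutes]
      simp
    by_cases hv0 : v = 0
    · have hy0 : y = 0 := hf (by rw [hy, hv0, map_zero])
      refine ⟨C ((f u).eval 0), ?_⟩
      rw [hy0, mul_zero, add_zero] at huy
      rw [aeval_C]
      exact huy.symm
    · have hlt : (f y).natDegree < n := by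
        have := congrArg natDegree hv
        rw [natDegree_mul hs0 hv0, natDegree_sub_C, natDegree_sub_C] at this
        rw [hy]
        omega
      obtain ⟨q, hq⟩ := ih _ hlt y rfl
      refine ⟨C ((f u).eval 0) + (X - C ((f w).eval 0)) * q, ?_⟩
      rw [map_add, map_mul, map_sub, aeval_X, aeval_C, aeval_C, hq]
      exact huy.symm

/-- `N` is generated by one `w`, and each `g` translates `w` by a constant; these constants define
`β`. -/
theorem exists_iso_univariate [Nontrivial G] {α : Additive G →+ k}
    (hα : Function.Injective α) (N : KGAlg k G) [IsIntegrallyClosed N.carrier]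
    (φ : univariate α ⟶ N) (f : N ⟶ univariate α) (hf : Function.Injective f.toAlgHom) :
    ∃ β : Additive G →+ k, Function.Injective β ∧ Nonempty (N ≅ univariate β) := by
  let F : N.carrier →ₐ[k] Polynomial k := f.toAlgHom
  have hF : Function.Injective F := hf
  have hFi : F.toRingHom.IsIntegral :=
    isIntegral_of_natDegree_pos F (φ.toAlgHom (univariateX α)) (natDegree_endo_pos hα (φ ≫ f))
  obtain ⟨w, hw, hgen⟩ := exists_generator F hF hFi
  have : Nontrivial N.carrier := F.toRingHom.domain_nontrivial
  have hFq : ∀ q, F (Polynomial.aeval w q) = q.comp (F w) := fun q => by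
    rw [← Polynomial.aeval_algHom_apply, Polynomial.comp_eq_aeval]
  have hact : ∀ g : G, ∃ c : k, N.act g w = w - algebraMap k _ c := by
    intro g
    obtain ⟨q, hq⟩ := hgen (N.act g w - w)
    have h1 : F (N.act g w) = Polynomial.taylor (-α (Additive.ofMul g)) (F w) := by
      rw [Polynomial.taylor_apply, Polynomial.C_neg, ← sub_eq_add_neg]
      exact (f.equivariant g w).trans (univariate_act_eq_comp α g _)
    -- Translating `F w` keeps degree and leading coefficient, so `q(F w)` has degree below that of
    -- `F w`; this forces `q` to be constant.
    have h2 : q.natDegree = 0 := by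
      have h3 : q.comp (F w) = Polynomial.taylor (-α (Additive.ofMul g)) (F w) - F w := by
        rw [← hFq, hq, map_sub, h1]
      have h4 : (q.comp (F w)).natDegree < (F w).natDegree := by
        have h5 : F w ≠ 0 := by
          rintro h
          simp [h] at hw
        rcases eq_or_ne (q.comp (F w)) 0 with h0 | h0
        · rwa [h0, Polynomial.natDegree_zero]
        · refine Polynomial.natDegree_lt_natDegree h0 ?_
          rw [h3]
          exact Polynomial.degree_sub_lt_right (Polynomial.degree_taylor _ _) h5
            (Polynomial.leadingCoeff_taylor _ _)
      rw [Polynomial.natDegree_comp] at h4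
      by_contra hne
      exact absurd h4 (not_lt.2 (Nat.le_mul_of_pos_left _ (Nat.pos_of_ne_zero hne)))
    refine ⟨-q.coeff 0, ?_⟩
    rw [Polynomial.eq_C_of_natDegree_eq_zero h2, Polynomial.aeval_C] at hq
    rw [map_neg, sub_neg_eq_add, hq]
    abel
  choose c hc using hact
  have hinj := (algebraMap k N.carrier).injective
  let β : Additive G →+ k := AddMonoidHom.mk' (fun g => c g.toMul) fun g h => by
    apply hinj
    have h1 := hc (g.toMul * h.toMul)
    rw [← act_act, hc, map_sub, hc, AlgHom.commutes] at h1
    have h2 : w - algebraMap k _ (c g.toMul + c h.toMul) =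
        w - algebraMap k _ (c (g.toMul * h.toMul)) := by
      rw [← h1, map_add]
      abel
    exact (sub_right_injective h2).symm
  have hβ : ∀ g, N.act g w = w - algebraMap k _ (β (Additive.ofMul g)) := hc
  have hβi : Function.Injective β := by
    rw [injective_iff_map_eq_zero]
    intro g hg
    -- If `β(g) = 0` then `g` acts trivially on `N`, but the image of `Z` under `φ` is moved by
    -- `α(g)`.
    have h1 : N.act g.toMul w = w := by
      rw [hβ, ofMul_toMul, hg, map_zero, sub_zero]
    have h2 : ∀ u, N.act g.toMul u = u := by
      intro u
      obtain ⟨q, rfl⟩ := hgen u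
      rw [← Polynomial.aeval_algHom_apply, h1]
    have h3 := φ.equivariant g.toMul (univariateX α)
    rw [h2, univariate_act_X, map_sub, AlgHom.commutes, sub_eq_self, ofMul_toMul] at h3
    rw [← map_eq_zero_iff α hα]
    exact hinj (h3.trans (map_zero _).symm)
  let ψ := univariateLift β N w hβ
  have hψ : Function.Bijective ψ.toAlgHom :=
    ⟨Function.Injective.of_comp (f := f.toAlgHom) (endo_injective hβi (ψ ≫ f)), hgen⟩
  exact ⟨β, hβi, ⟨(isoOfInverse ψ (AlgEquiv.ofBijective ψ.toAlgHom hψ).symm.toAlgHom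
    (AlgHom.ext fun a => (AlgEquiv.ofBijective ψ.toAlgHom hψ).symm_apply_apply a)
    (AlgHom.ext fun a => (AlgEquiv.ofBijective ψ.toAlgHom hψ).apply_symm_apply a)).symm⟩⟩
-- Isomorphisms and twists of the algebras `B_α`
theorem univariate_iso_iff {α β : Additive G →+ k} :
    Nonempty (univariate α ≅ univariate β) ↔ ∃ c : k, c ≠ 0 ∧ ∀ g, α g = c * β g := by
  constructor
  · rintro ⟨i⟩
    let q : Polynomial k := i.hom.toAlgHom (univariateX α)
    let r : Polynomial k := i.inv.toAlgHom (univariateX β)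
    have hrq : r.comp q = Polynomial.X := by
      refine (endo_eq_comp i.hom r).symm.trans ?_
      exact DFunLike.congr_fun (congrArg Hom.toAlgHom i.inv_hom_id) (univariateX β)
    -- Degrees multiply under composition, so `Z ↦ aZ + b`; equivariance evaluated at `0` then gives
    -- `α = aβ`.
    have hq : q.natDegree = 1 := by
      have := congrArg Polynomial.natDegree hrq
      rw [Polynomial.natDegree_comp, Polynomial.natDegree_X] at this
      exact Nat.eq_one_of_mul_eq_one_left this
    obtain ⟨a, b, hab⟩ := Polynomial.exists_eq_X_add_C_of_natDegree_le_one hq.le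
    refine ⟨a, ?_, fun g => ?_⟩
    · rintro rfl
      rw [hab] at hq
      simp at hq
    · have h1 : q - Polynomial.C (α g) = q.comp (Polynomial.X - Polynomial.C (β g)) := by
        refine Eq.trans ?_ ((i.hom.equivariant g.toMul (univariateX α)).trans
          (univariate_act_eq_comp β _ _))
        rw [univariate_act_X, map_sub, AlgHom.commutes]
        rfl
      rw [hab] at h1
      have h2 := congrArg (Polynomial.eval 0) h1
      simp only [Polynomial.eval_sub, Polynomial.eval_add, Polynomial.eval_mul, Polynomial.eval_C,
        Polynomial.eval_X, Polynomial.eval_comp] at h2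
      linear_combination -h2
  · rintro ⟨c, hc, h⟩
    have hα : ∀ g, (univariate β).act g (c • univariateX β) =
        c • univariateX β - algebraMap k _ (α (Additive.ofMul g)) := by
      intro g
      rw [map_smul, univariate_act_X, smul_sub, h, map_mul, ← Algebra.smul_def]
    have hβ : ∀ g, (univariate α).act g (c⁻¹ • univariateX α) =
        c⁻¹ • univariateX α - algebraMap k _ (β (Additive.ofMul g)) := by
      intro g
      rw [map_smul, univariate_act_X, smul_sub, h, map_mul, ← Algebra.smul_def, smul_smul,
        inv_mul_cancel₀ hc, one_smul]
    refine ⟨⟨univariateLift α _ _ hα, univariateLift β _ _ hβ, hom_ext (univariate_algHom_ext ?_),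
      hom_ext (univariate_algHom_ext ?_)⟩⟩
    · rw [comp_toAlgHom, AlgHom.comp_apply, univariateLift_X, map_smul, univariateLift_X, smul_smul,
        mul_inv_cancel₀ hc, one_smul]
      rfl
    · rw [comp_toAlgHom, AlgHom.comp_apply, univariateLift_X, map_smul, univariateLift_X, smul_smul,
        inv_mul_cancel₀ hc, one_smul]
      rfl

theorem twist_univariate (β : Additive G →+ k) (η : G ≃* G) :
    (univariate β).twist η = univariate (β.comp (MonoidHom.toAdditive η.toMonoidHom)) := rfl

theorem univariate_iso_twist_iff {α β : Additive G →+ k}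
    (hα : Function.Injective α) (hβ : Function.Injective β) :
    (∃ η : G ≃* G, Nonempty (univariate α ≅ (univariate β).twist η)) ↔
      ∃ c : k, c ≠ 0 ∧ Set.range α = (fun x => c * x) '' Set.range β := by
  simp only [twist_univariate, univariate_iso_iff]
  constructor
  · rintro ⟨η, c, hc, h⟩
    refine ⟨c, hc, Set.ext fun x => ⟨?_, ?_⟩⟩
    · rintro ⟨g, rfl⟩
      exact ⟨_, ⟨_, rfl⟩, (h g).symm⟩
    · rintro ⟨_, ⟨g, rfl⟩, rfl⟩
      refine ⟨Additive.ofMul (η.symm g.toMul), (h _).trans ?_⟩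
      change c * β (Additive.ofMul (η (η.symm g.toMul))) = c * β g
      rw [η.apply_symm_apply]
      rfl
  · rintro ⟨c, hc, h⟩
    have h1 : ∀ g, ∃ g', α g = c * β g' := by
      intro g
      have : α g ∈ (fun x => c * x) '' Set.range β := h ▸ ⟨g, rfl⟩
      obtain ⟨_, ⟨g', rfl⟩, hg'⟩ := this
      exact ⟨g', hg'.symm⟩
    have h2 : ∀ g', ∃ g, α g = c * β g' := by
      intro g'
      have : c * β g' ∈ Set.range α := h ▸ ⟨_, ⟨g', rfl⟩, rfl⟩
      exact this
    -- The automorphism is `η = β⁻¹ ∘ (c⁻¹ α)`.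
    choose f hf using h1
    have hinj : ∀ {x y}, c * β x = c * β y → x = y := fun hxy => hβ (mul_left_cancel₀ hc hxy)
    let φ : Additive G →+ Additive G := AddMonoidHom.mk' f fun x y => hinj <| by
      rw [← hf, map_add, map_add, mul_add, ← hf, ← hf]
    have hφ : Function.Bijective φ := by
      constructor
      · intro x y hxy
        refine hα ?_
        rw [hf, hf]
        exact congrArg (fun z => c * β z) hxy
      · intro y
        obtain ⟨x, hx⟩ := h2 y
        exact ⟨x, hinj ((hf x).symm.trans hx)⟩
    exact ⟨MulEquiv.toAdditive.symm (AddEquiv.ofBijective φ hφ), c, hc, hf⟩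

/-! ### Changing the translations, and tensor products -/

section Shift

variable {ι : Type}

theorem orbitSum_add [Fintype G] (A : KGAlg k G) (l l' : Additive G →+ k) (a : A.carrier) :
    A.orbitSum (l + l') a = A.orbitSum l a + A.orbitSum l' a := by
  simp only [orbitSum, AddMonoidHom.add_apply, add_smul, Finset.sum_add_distrib]

theorem orbitSum_zero [Fintype G] (A : KGAlg k G) (a : A.carrier) :
    A.orbitSum 0 a = 0 := by
  simp [orbitSum]

/-- The morphism `B_{l_j} ⟶ k[Y_i]`, `Z ↦ Y_j`. -/
def toShift (l : ι → Additive G →+ k) (j : ι) : univariate (l j) ⟶ shift l :=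
  univariateLift _ _ (shiftX l j) fun g => shift_act_X l g j

/-- The morphism `Y_i ↦ Y_i + u_i(Y_j)` correcting the translations `l` to `l'`. -/
def shiftCorrect [Fintype G] (l l' : ι → Additive G →+ k) {α : Additive G →+ k}
    (E : univariate α ⟶ shift l') {a : (univariate α).carrier} (ha : (univariate α).trace a = 1) :
    shift l ⟶ shift l' :=
  shiftLift l _ (fun i => shiftX l' i + E.toAlgHom ((univariate α).orbitSum (l i - l' i) a))
    fun g i => by
      rw [map_add, shift_act_X, ← E.equivariant, act_orbitSum _ _ ha, map_sub, AlgHom.commutes,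
        AddMonoidHom.sub_apply, map_sub]
      abel

theorem shiftCorrect_X [Fintype G] (l l' : ι → Additive G →+ k) {α : Additive G →+ k}
    (E : univariate α ⟶ shift l') {a : (univariate α).carrier} (ha : (univariate α).trace a = 1)
    (i : ι) : (shiftCorrect l l' E ha).toAlgHom (shiftX l i) =
      shiftX l' i + E.toAlgHom ((univariate α).orbitSum (l i - l' i) a) :=
  shiftLift_X _ _ _ _ i

/-- The correction of `Y_j` vanishes, so `Y_j` is preserved. The other corrections are polynomials
in `Y_j` alone, additive in `l i - l' i`, and cancel in the composite. -/
theorem shiftCorrect_comp [Fintype G] {l l' : ι → Additive G →+ k} {j : ι} {α : Additive G →+ k}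
    (hj : l j = l' j) (E : univariate α ⟶ shift l) (E' : univariate α ⟶ shift l')
    (hE : E.toAlgHom (univariateX α) = shiftX l j) (hE' : E'.toAlgHom (univariateX α) = shiftX l' j)
    {a : (univariate α).carrier} (ha : (univariate α).trace a = 1) :
    shiftCorrect l l' E' ha ≫ shiftCorrect l' l E ha = 𝟙 _ := by
  have h : (shiftCorrect l' l E ha).toAlgHom.comp E'.toAlgHom = E.toAlgHom := by
    refine univariate_algHom_ext ?_
    rw [AlgHom.comp_apply, hE', shiftCorrect_X, hj, sub_self, orbitSum_zero, map_zero, add_zero, hE]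
  refine hom_ext (shift_algHom_ext fun i => ?_)
  rw [comp_toAlgHom, AlgHom.comp_apply, shiftCorrect_X, map_add, shiftCorrect_X,
    ← AlgHom.comp_apply, h, add_assoc, ← map_add, ← orbitSum_add, sub_add_sub_cancel, sub_self,
    orbitSum_zero, map_zero, add_zero]
  rfl

theorem nonempty_shift_iso [Fintype G] {l l' : ι → Additive G →+ k} {j : ι}
    (hj : l j = l' j) (h : ∃ a, (univariate (l j)).trace a = 1) :
    Nonempty (shift l ≅ shift l') := by
  obtain ⟨a, ha⟩ := h
  let E' : univariate (l j) ⟶ shift l' := univariateLift _ _ (shiftX l' j) fun g => by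
    rw [hj, shift_act_X]
  have hE : (toShift l j).toAlgHom (univariateX _) = shiftX l j := univariateLift_X _ _ _ _
  have hE' : E'.toAlgHom (univariateX _) = shiftX l' j := univariateLift_X _ _ _ _
  exact ⟨⟨shiftCorrect l l' E' ha, shiftCorrect l' l (toShift l j) ha,
    shiftCorrect_comp hj _ _ hE hE' ha, shiftCorrect_comp hj.symm _ _ hE' hE ha⟩⟩

/-- The linear change of variables replacing `Y_j` by `∑ a_i Y_i` is invertible because `a_j ≠ 0`.
-/
theorem nonempty_shift_iso_update [Fintype ι] [DecidableEq ι] (l : ι → Additive G →+ k)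
    (a : ι → k) (j : ι) (hj : a j ≠ 0) (α : Additive G →+ k) (hα : ∀ g, α g = ∑ i, a i * l i g) :
    Nonempty (shift l ≅ shift (Function.update l j α)) := by
  let μ := Function.update l j α
  let f : shift μ ⟶ shift l := shiftLift μ _
    (Function.update (shiftX l) j (∑ i, a i • shiftX l i)) fun g i => by
      rcases eq_or_ne i j with rfl | hi
      · simp only [μ, Function.update_self, map_sum, map_smul, shift_act_X, smul_sub,
          Finset.sum_sub_distrib, hα]
        simp only [map_mul, ← Algebra.smul_def]
      · simp only [μ, Function.update_of_ne hi, shift_act_X]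
  let φ : (shift l).carrier →ₐ[k] (shift μ).carrier :=
    (MvPolynomial.aeval (Function.update (shiftX μ) j
      ((a j)⁻¹ • (shiftX μ j - ∑ i ∈ Finset.univ.erase j, a i • shiftX μ i))) :
      MvPolynomial ι k →ₐ[k] (shift μ).carrier)
  have hφ : ∀ i, φ (shiftX l i) = Function.update (shiftX μ) j
      ((a j)⁻¹ • (shiftX μ j - ∑ i ∈ Finset.univ.erase j, a i • shiftX μ i)) i := fun i =>
    MvPolynomial.aeval_X _ _
  have hf : ∀ i, f.toAlgHom (shiftX μ i) =
      Function.update (shiftX l) j (∑ i, a i • shiftX l i) i := fun i => shiftLift_X _ _ _ _ i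
  refine ⟨(isoOfInverse f φ (shift_algHom_ext fun i => ?_) (shift_algHom_ext fun i => ?_)).symm⟩
  · rw [AlgHom.comp_apply, hf, AlgHom.id_apply]
    rcases eq_or_ne i j with rfl | hi
    · rw [Function.update_self, map_sum, ← Finset.add_sum_erase _ _ (Finset.mem_univ i), map_smul,
        hφ, Function.update_self, smul_smul, mul_inv_cancel₀ hj, one_smul]
      have h : ∀ x ∈ Finset.univ.erase i, φ (a x • shiftX l x) = a x • shiftX μ x := fun x hx => by
        rw [map_smul, hφ, Function.update_of_ne (Finset.ne_of_mem_erase hx)]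
      rw [Finset.sum_congr rfl h, sub_add_cancel]
    · rw [Function.update_of_ne hi, hφ, Function.update_of_ne hi]
  · rw [AlgHom.comp_apply, hφ, AlgHom.id_apply]
    rcases eq_or_ne i j with rfl | hi
    · rw [Function.update_self, map_smul, map_sub, map_sum, hf, Function.update_self,
        ← Finset.add_sum_erase _ _ (Finset.mem_univ i)]
      have h : ∀ x ∈ Finset.univ.erase i, f.toAlgHom (a x • shiftX μ x) = a x • shiftX l x :=
        fun x hx => by rw [map_smul, hf, Function.update_of_ne (Finset.ne_of_mem_erase hx)]
      rw [Finset.sum_congr rfl h, add_sub_cancel_right, smul_smul, inv_mul_cancel₀ hj, one_smul]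
    · rw [Function.update_of_ne hi, hf, Function.update_of_ne hi]

theorem tensor_act_tprod (A : ι → KGAlg k G) (g : G) (x : ∀ i, (A i).carrier) :
    (tensor A).act g (PiTensorProduct.tprod k x : ⨂[k] i, (A i).carrier) =
      (PiTensorProduct.tprod k fun i => (A i).act g (x i) : ⨂[k] i, (A i).carrier) :=
  PiTensorProduct.lift.tprod (E := ⨂[k] i, (A i).carrier)
    (φ := (PiTensorProduct.tprod k).compLinearMap fun i => ((A i).act g).toLinearMap) x

theorem nonempty_shift_iso_tensor [Fintype ι] (l : ι → Additive G →+ k) :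
    Nonempty (shift l ≅ tensor fun i => univariate (l i)) := by
  classical
  let s : ∀ i, (univariate (l i)).carrier →ₐ[k] (tensor fun i => univariate (l i)).carrier :=
    fun i => PiTensorProduct.singleAlgHom (A := fun i => (univariate (l i)).carrier) i
  have hs : ∀ g i x, (tensor fun i => univariate (l i)).act g (s i x) =
      s i ((univariate (l i)).act g x) := by
    intro g i x
    refine (tensor_act_tprod _ g _).trans (congrArg _ (funext fun i' => ?_))
    rcases eq_or_ne i' i with rfl | hi
    · simp
    · simp [hi]
  let f : shift l ⟶ tensor fun i => univariate (l i) := shiftLift l _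
    (fun i => s i (univariateX (l i))) fun g i => by
      rw [hs, univariate_act_X, map_sub, AlgHom.commutes]
  have hf : ∀ i, f.toAlgHom (shiftX l i) = s i (univariateX (l i)) := fun i => shiftLift_X _ _ _ _ i
  let φ : (tensor fun i => univariate (l i)).carrier →ₐ[k] (shift l).carrier :=
    PiTensorProduct.liftAlgHom
      ((MultilinearMap.mkPiAlgebra k ι (shift l).carrier).compLinearMap
        fun i => ((toShift l i).toAlgHom).toLinearMap) (by simp) (fun x y => by
          simp [Finset.prod_mul_distrib])
  have hφ : ∀ i, φ (s i (univariateX (l i))) = shiftX l i := by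
    intro i
    refine (PiTensorProduct.lift.tprod _).trans ?_
    rw [MultilinearMap.compLinearMap_apply, MultilinearMap.mkPiAlgebra_apply,
      Finset.prod_eq_single_of_mem i (Finset.mem_univ i)]
    · rw [MonoidHom.mulSingle_apply, Pi.mulSingle_eq_same]
      exact univariateLift_X _ _ _ fun g => shift_act_X l g i
    · intro i' _ hi
      rw [MonoidHom.mulSingle_apply, Pi.mulSingle_eq_of_ne hi]
      exact map_one (toShift l i').toAlgHom
  refine ⟨isoOfInverse f φ (shift_algHom_ext fun i => ?_)
    (PiTensorProduct.algHom_ext fun i => univariate_algHom_ext ?_)⟩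
  · rw [AlgHom.comp_apply, hf, hφ, AlgHom.id_apply]
  · change f.toAlgHom (φ (s i (univariateX (l i)))) = s i (univariateX (l i))
    rw [hφ, hf]

end Shift
-- Basic objects
/-- A basic object and `B_α` map to each other, the former injectively. -/
theorem IsBasic.exists_hom [Fintype G] {α : Additive G →+ k} (hα : Function.Injective α)
    [Nontrivial G] (hαT : IsTs (univariate α)) {ι : Type} [Finite ι] {l : ι → Additive G →+ k}
    (hl : IsTs (shift l)) {B : KGAlg k G} (hB : IsBasic B) :
    ∃ (_ : univariate α ⟶ B) (f : B ⟶ univariate α), Function.Injective f.toAlgHom := by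
  obtain ⟨φ⟩ := nonempty_hom_univariate α hB.1.1
  obtain ⟨ψ⟩ := hB.1.2 _ hαT
  have hφ : Function.Injective φ.toAlgHom :=
    Function.Injective.of_comp (f := ψ.toAlgHom) (endo_injective hα (φ ≫ ψ))
  -- Minimality of `B` turns `B_α ≺ B` into `B ≺ B_α`.
  obtain ⟨f, hf⟩ := hB.2.2 _ hαT ⟨φ, isTsMono_of_injective φ hφ⟩
  exact ⟨φ, f, injective_of_isTsMono hl hB.1.1 f hf⟩

theorem IsBasic.ringKrullDim_eq_one [Fintype G] {α : Additive G →+ k} (hα : Function.Injective α)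
    [Nontrivial G] (hαT : IsTs (univariate α)) {ι : Type} [Finite ι] {l : ι → Additive G →+ k}
    (hl : IsTs (shift l)) {B : KGAlg k G} (hB : IsBasic B) : ringKrullDim B.carrier = 1 := by
  obtain ⟨φ, f, hf⟩ := hB.exists_hom hα hαT hl
  let F : B.carrier →ₐ[k] Polynomial k := f.toAlgHom
  exact ringKrullDim_eq_one_of_isIntegral (k := k) F.toRingHom hf
    (isIntegral_of_natDegree_pos F
      (φ.toAlgHom (univariateX α)) (natDegree_endo_pos hα (φ ≫ f)))

/-! ### Coordinates on `G` and their consequences for `℧` -/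

section Coord

variable {p n : ℕ} [Algebra (ZMod p) k] (e : Additive G ≃+ (Fin n → ZMod p))

theorem exists_eq_sum_coord (α : Additive G →+ k) :
    ∃ a : Fin n → k, (∀ i, a i = α (e.symm (Pi.single i 1))) ∧
      ∀ g, α g = ∑ i, a i * coord e i g := by
  refine ⟨fun i => α (e.symm (Pi.single i 1)), fun _ => rfl, fun g => ?_⟩
  let γ : (Fin n → ZMod p) →+ k := α.comp e.symm.toAddMonoidHom
  have hz : ∀ (c : ZMod p) (i : Fin n),
      γ (Pi.single i c) = γ (Pi.single i 1) * algebraMap (ZMod p) k c := by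
    intro c i
    let F : ZMod p →+ k := γ.comp (AddMonoidHom.single (fun _ => ZMod p) i)
    have hF : F (c • 1) = c • F 1 := ZMod.map_smul F c 1
    rw [smul_eq_mul, mul_one, Algebra.smul_def, mul_comm] at hF
    exact hF
  have hg : α g = γ (e g) := congrArg α (e.symm_apply_apply g).symm
  rw [hg, ← Finset.univ_sum_single (e g), map_sum]
  exact Finset.sum_congr rfl fun i _ => (hz _ i).trans rfl

theorem coordHom_injective {a : Fin n → k} (ha : LinearIndependent (ZMod p) a) :
    Function.Injective (coordHom e a) := by
  rw [injective_iff_map_eq_zero]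
  intro g hg
  have := Fintype.linearIndependent_iff.1 ha (e g) hg
  rw [← map_eq_zero_iff e e.injective]
  exact funext this

theorem range_coordHom (a : Fin n → k) :
    Set.range (coordHom e a) = (Submodule.span (ZMod p) (Set.range a) : Set k) := by
  ext x
  rw [SetLike.mem_coe, Submodule.mem_span_range_iff_exists_fun]
  constructor
  · rintro ⟨g, rfl⟩
    exact ⟨e g, rfl⟩
  · rintro ⟨c, rfl⟩
    refine ⟨e.symm c, ?_⟩
    change ∑ i, e (e.symm c) i • a i = _
    rw [e.apply_symm_apply]

/-- Write `α = ∑ a_j g_j` and include by `Z ↦ ∑ a_j Y_j`. Sending `Y_j` to the `g_j`-weighted orbit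
sum of `b` is a retraction, since these combine to the `α`-weighted orbit sum, which is `Z`. -/
theorem nonempty_retract [Fintype G] (α : Additive G →+ k) (b : (univariate α).carrier)
    (hb : (univariate α).trace b = 1) (hbα : (univariate α).orbitSum α b = univariateX α) :
    Nonempty (Retract (univariate α) (multivariate (k := k) e)) := by
  obtain ⟨a, -, ha⟩ := exists_eq_sum_coord e α
  let i : univariate α ⟶ shift (coord e) :=
    univariateLift α _ (∑ j, a j • shiftX (coord e) j) fun g => by
      simp only [map_sum, map_smul, shift_act_X, smul_sub, Finset.sum_sub_distrib, ha]
      simp only [map_mul, ← Algebra.smul_def]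
  let r : shift (coord e) ⟶ univariate α :=
    shiftLift (coord e) _ (fun j => (univariate α).orbitSum (coord e j) b)
      fun g j => act_orbitSum _ _ hb g
  have h1 : ∀ j, r.toAlgHom (shiftX (coord e) j) = (univariate α).orbitSum (coord e j) b :=
    fun j => shiftLift_X _ _ _ _ j
  have h2 : i.toAlgHom (univariateX α) = ∑ j, a j • shiftX (coord e) j := univariateLift_X _ _ _ _
  refine ⟨⟨i, r, hom_ext (univariate_algHom_ext ?_)⟩⟩
  change r.toAlgHom (i.toAlgHom (univariateX α)) = univariateX α
  rw [h2, map_sum]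
  refine Eq.trans ?_ hbα
  simp only [map_smul, h1, orbitSum, Finset.smul_sum, smul_smul]
  rw [Finset.sum_comm]
  simp only [← Finset.sum_smul, ← ha]

/-- A linear change of variables makes one coordinate carry its prescribed embedding; the others are
then corrected by polynomials in that variable. -/
theorem nonempty_iso_tensor [Fact p.Prime] [Fintype G] (hn : 1 ≤ n)
    (α : Fin n → (Additive G →+ k)) (hα : ∀ s, Function.Injective (α s))
    (h : ∀ s, ∃ a, (univariate (α s)).trace a = 1) :
    Nonempty (multivariate (k := k) e ≅ tensor fun s => univariate (α s)) := by
  let j : Fin n := ⟨0, hn⟩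
  obtain ⟨a, ha, hαa⟩ := exists_eq_sum_coord e (α j)
  have haj : a j ≠ 0 := by
    rw [ha, Ne, map_eq_zero_iff _ (hα j), map_eq_zero_iff _ e.symm.injective]
    simp
  obtain ⟨i₁⟩ := nonempty_shift_iso_update (coord e) a j haj (α j) hαa
  have hj : α j = Function.update (coord e) j (α j) j := by rw [Function.update_self]
  obtain ⟨i₂⟩ := nonempty_shift_iso hj (h j)
  obtain ⟨i₃⟩ := nonempty_shift_iso_tensor α
  exact ⟨i₁ ≪≫ i₂.symm ≪≫ i₃⟩

end Coord

end

end KGAlg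

theorem mainTheorem10 {k : Type u} [Field k] {p : ℕ} [Fact p.Prime] [CharP k p]
    [Algebra (ZMod p) k] {n : ℕ} (hn : 1 ≤ n) {G : Type} [Group G] [Fintype G]
    (e : Additive G ≃+ (Fin n → ZMod p)) :
    (KGAlg.IsStandard (KGAlg.multivariate (k := k) e) ∧
      KGAlg.IsUniversal (KGAlg.multivariate (k := k) e)) ∧
    ((n : Cardinal.{u}) ≤ Module.rank (ZMod p) k →
      -- existence of the embedding `α : G → W`
      (∃ a : Fin n → k, LinearIndependent (ZMod p) a ∧
        Function.Injective (KGAlg.coordHom e a) ∧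
        Set.range (KGAlg.coordHom e a) = (Submodule.span (ZMod p) (Set.range a) : Set k)) ∧
      -- (1)
      (∀ α : Additive G →+ k, Function.Injective α →
        Nonempty (Retract (KGAlg.univariate α) (KGAlg.multivariate (k := k) e)) ∧
        KGAlg.IsStandard (KGAlg.univariate α) ∧
        KGAlg.IsUniversal (KGAlg.univariate α) ∧
        KGAlg.IsBasic (KGAlg.univariate α)) ∧
      KGAlg.HasBasicDimension k G 1 ∧
      -- (2)
      (∀ N : KGAlg k G, KGAlg.IsBasic N → IsIntegrallyClosed N.carrier →
        ∃ β : Additive G →+ k, Function.Injective β ∧ Nonempty (N ≅ KGAlg.univariate β)) ∧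
      -- (3)
      (∀ α β : Additive G →+ k, Function.Injective α → Function.Injective β →
        (Nonempty (KGAlg.univariate α ≅ KGAlg.univariate β) ↔
          ∃ c : k, c ≠ 0 ∧ ∀ g, α g = c * β g) ∧
        ((∃ η : G ≃* G,
            Nonempty (KGAlg.univariate α ≅ (KGAlg.univariate β).twist η)) ↔
          ∃ c : k, c ≠ 0 ∧ Set.range α = (fun x => c * x) '' Set.range β)) ∧
      -- (4)
      (∀ α : Fin n → (Additive G →+ k), (∀ s, Function.Injective (α s)) →
        Nonempty (KGAlg.multivariate (k := k) e ≅
          KGAlg.tensor fun s => KGAlg.univariate (α s)))) := by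
  have hcomm : ∀ g h : G, g * h = h * g := fun g h =>
    Additive.ofMul.injective <| e.injective <| by rw [ofMul_mul, ofMul_mul, map_add, map_add, add_comm]
  have : Nonempty (Fin n) := ⟨⟨0, hn⟩⟩
  have : Nontrivial G := (Additive.ofMul.trans e.toEquiv).nontrivial
  obtain ⟨a, ha, hac⟩ := KGAlg.exists_trace_eq_one_coord (k := k) e
  have hshift : KGAlg.IsTs (KGAlg.shift (KGAlg.coord (k := k) e)) := KGAlg.isTs_shift ⟨a, ha⟩
  rw [KGAlg.multivariate_eq_shift]
  refine ⟨⟨KGAlg.isStandard_shift _ a ha hac, hshift,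
    fun A hA => KGAlg.nonempty_hom_shift (KGAlg.coord e) hA⟩, fun hrank => ?_⟩
  obtain ⟨v, hv⟩ := Module.le_rank_iff.1 hrank
  have hTs : ∀ α : Additive G →+ k, Function.Injective α → KGAlg.IsTs (KGAlg.univariate α) := by
    intro α hα
    obtain ⟨b, hb, -⟩ := KGAlg.exists_trace_eq_one_univariate hα hcomm
    exact KGAlg.isTs_univariate ⟨b, hb⟩
  have hbasic : ∀ α : Additive G →+ k, Function.Injective α →
      KGAlg.IsBasic (KGAlg.univariate α) := fun α hα =>
    ⟨KGAlg.isUniversal_univariate (hTs α hα), KGAlg.isMinimal_univariate hα (hTs α hα)⟩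
  have hvi := KGAlg.coordHom_injective e hv
  refine ⟨⟨v, hv, hvi, KGAlg.range_coordHom e v⟩, ?_, ⟨⟨_, hbasic _ hvi⟩, ?_⟩, ?_, ?_, ?_⟩
  · intro α hα
    obtain ⟨b, hb, hbα⟩ := KGAlg.exists_trace_eq_one_univariate hα hcomm
    exact ⟨KGAlg.nonempty_retract e α b hb hbα, KGAlg.isStandard_univariate α b hb hbα,
      (hbasic α hα).1, hbasic α hα⟩
  · intro B hB
    exact_mod_cast hB.ringKrullDim_eq_one hvi (hTs _ hvi) hshift
  · intro N hN hNc
    obtain ⟨φ, f, hf⟩ := hN.exists_hom hvi (hTs _ hvi) hshift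
    exact KGAlg.exists_iso_univariate hvi N φ f hf
  · exact fun α β hα hβ => ⟨KGAlg.univariate_iso_iff, KGAlg.univariate_iso_twist_iff hα hβ⟩
  · exact fun α hα => KGAlg.nonempty_iso_tensor e hn α hα fun s =>
      ((KGAlg.isTs_iff _).1 (hTs _ (hα s))).2
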